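/- Consider the two-parameter family of three-step IMEX multistep methods with real parameters $(\beta_1,\beta_0)$, $$u_n=\tfrac34u_{n-1}+\tfrac14u_{n-3}+\tfrac32\Delta t\,F_{n-1}+\sum_{j=0}^3\beta_j\Delta t\,G_{n-j},\qquad \beta_2=3-3\beta_0-2\beta_1,\quad \beta_3=2\beta_0+\beta_1-\tfrac32 .$$ For the test functions with $\Delta t\,G(u)=\xi u$, $\Delta t\,F(u)=i\eta u$ ($\xi\le 0$, $\eta\in\mathbb{R}$) its characteristic polynomial is $$P_{\beta_1,\beta_0}(\zeta,\xi,\eta)=(1-\beta_0\xi)\zeta^3-\Bigl(\tfrac34+\beta_1\xi+\tfrac{3i\eta}{2}\Bigr)\zeta^2+\xi(3\beta_0+2\beta_1-3)\zeta-\Bigl(\tfrac14+2\beta_0\xi+\beta_1\xi-\tfrac32\xi\Bigr).$$ Let the stability region $\mathcal{S}_{\beta_1,\beta_0}$ be the set of all $(\xi,\eta)\in\mathbb{R}^2$ with $\xi\le 0$ such that $P_{\beta_1,\beta_0}(\cdot,\xi,\eta)$ has degree at least $1$ (in $\zeta$), all its roots satisfy $|\zeta|\le 1$, and its roots with $|\zeta|=1$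 are simple. Let $$W=\Bigl\{(\beta_1,\beta_0)\in\mathbb{R}^2:\ \beta_1\le\tfrac34,\ \tfrac{3-2\beta_1}{4}\le\beta_0\le\tfrac{9-8\beta_1}{8}\Bigr\},\qquad \mathcal{P}_m=\{(\xi,\eta)\in\mathbb{R}^2:\ \xi\le 0,\ \eta^2\le m|\xi|\}.$$ Then: 1. The largest $m>0$ for which there is $(\beta_1,\beta_0)\in W$ with $\mathcal{P}_m\subset\mathcal{S}_{\beta_1,\beta_0}$ is $m=6/5$ (in particular, the maximum is attained). 2. For $(\beta_1,\beta_0)\in W$, the inclusion $\mathcal{P}_{6/5}\subset\mathcal{S}_{\beta_1,\beta_0}$ holds if and only if $(\beta_1,\beta_0)=(1/5,37/40)$. 3. In the open quadrant $\{\xi<0,\ \eta>0\}$, the boundaries of $\mathcal{P}_{6/5}$ and of $\mathcal{S}_{1/5,37/40}$ have exactly one common point, namely $\bigl(-\tfrac{10}{7},\,2\sqrt{3/7}\bigr)$. -/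

import Mathlib

namespace IMEX

/-- Simple von Neumann polynomials: degree at least one, all roots in the closed unit disk,
roots of modulus one are simple. -/
def IsSimpleVonNeumann (Q : Polynomial ℂ) : Prop :=
  1 ≤ Q.natDegree ∧ ∀ z : ℂ, Q.IsRoot z → ‖z‖ ≤ 1 ∧ (‖z‖ = 1 → Q.rootMultiplicity z = 1)

/-- The characteristic polynomial (in `ζ`) of the member `(β₁, β₀)` of the two-parameter IMEX
family, for the linear test functions with implicit part `ξ` and explicit part `i η`. -/
noncomputable def charPoly (β₁ β₀ ξ η : ℝ) : Polynomial ℂ :=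
  Polynomial.C (1 - (β₀ : ℂ) * ξ) * Polynomial.X ^ 3
    - Polynomial.C (3 / 4 + (β₁ : ℂ) * ξ + 3 * Complex.I * η / 2) * Polynomial.X ^ 2
    + Polynomial.C ((ξ : ℂ) * (3 * β₀ + 2 * β₁ - 3)) * Polynomial.X
    - Polynomial.C (1 / 4 + 2 * (β₀ : ℂ) * ξ + β₁ * ξ - 3 / 2 * ξ)

/-- The stability region, as a set of points `(ξ, η)`. -/
def stabilityRegion (β₁ β₀ : ℝ) : Set (ℝ × ℝ) :=
  {p | p.1 ≤ 0 ∧ IsSimpleVonNeumann (charPoly β₁ β₀ p.1 p.2)}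

/-- The parameter wedge, as a set of pairs `(β₁, β₀)`. -/
def W : Set (ℝ × ℝ) :=
  {β | β.1 ≤ 3 / 4 ∧ (3 - 2 * β.1) / 4 ≤ β.2 ∧ β.2 ≤ (9 - 8 * β.1) / 8}

/-- The (filled) parabola `η² ≤ m |ξ|` in the closed left half-plane. -/
def parabola (m : ℝ) : Set (ℝ × ℝ) :=
  {p | p.1 ≤ 0 ∧ p.2 ^ 2 ≤ m * |p.1|}

end IMEX

open Polynomial Filter Topology Set

namespace IMEX

/-! For `ξ < 0`, strict stability can end only on the root locus, where some `ζ = c + i s` with `|ζ|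
= 1` is a root. The wedge `W` is the quadrant `u, v ≥ 0` for `u = 2β₀ + β₁ - 3/2`, `v = 9/2 - 4β₀ -
4β₁`. Put `ξ = -q` and `b = 3(1+c) - 2v(1-c)`. Eliminating `u` along the locus gives `η²/q =
(1-c)(1+5c+qb/2)² / (9(1+c)q)`. If `1+5c` and `b` are positive, AM-GM bounds this below by
`2(1-c)(1+5c)b / (9(1+c))`, with equality when `qb/2 = 1+5c`.

For `u > 0` the locus attains this equality at some `c` (`exists_critical_cosine`). Since `b ≤
3(1+c)`, there `η²/q ≤ (2/3)(1-c)(1+5c) ≤ 6/5`, with equality throughout only for `c = 2/5`, `v =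
0`, hence `u = 11/20`. Every other locus thus enters the interior of the parabola, which is fatal
because the locus point is a limit of unstable points (`mem_closure_compl_stabilityRegion`).

For the optimal pair the locus only touches the parabola (`locus_optimal`). Connectedness then
spreads strict stability from `(-1, 0)` over its interior, and a limit argument with simplicity of
the remaining unimodular roots gives the boundary. -/

theorem charPoly_eval (β₁ β₀ ξ η : ℝ) (z : ℂ) :
    (charPoly β₁ β₀ ξ η).eval z = (1 - (β₀ : ℂ) * ξ) * z ^ 3
      - (3 / 4 + (β₁ : ℂ) * ξ + 3 * Complex.I * η / 2) * z ^ 2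
      + ((ξ : ℂ) * (3 * β₀ + 2 * β₁ - 3)) * z
      - (1 / 4 + 2 * (β₀ : ℂ) * ξ + β₁ * ξ - 3 / 2 * ξ) := by
  simp [charPoly]

theorem charPoly_eq_cubic (β₁ β₀ ξ η : ℝ) :
    charPoly β₁ β₀ ξ η = C (1 - (β₀ : ℂ) * ξ) * X ^ 3
      + C (-(3 / 4 + (β₁ : ℂ) * ξ + 3 * Complex.I * η / 2)) * X ^ 2
      + C ((ξ : ℂ) * (3 * β₀ + 2 * β₁ - 3)) * X
      + C (-(1 / 4 + 2 * (β₀ : ℂ) * ξ + β₁ * ξ - 3 / 2 * ξ)) := by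
  simp only [charPoly, map_neg]
  ring

theorem one_sub_mul_ne_zero {β₀ ξ : ℝ} (h : 0 < 1 - β₀ * ξ) : (1 - (β₀ : ℂ) * ξ) ≠ 0 := by
  exact_mod_cast h.ne'

theorem natDegree_charPoly {β₁ β₀ ξ η : ℝ} (h : 0 < 1 - β₀ * ξ) :
    (charPoly β₁ β₀ ξ η).natDegree = 3 := by
  rw [charPoly_eq_cubic]
  exact natDegree_cubic (one_sub_mul_ne_zero h)

theorem leadingCoeff_charPoly {β₁ β₀ ξ η : ℝ} (h : 0 < 1 - β₀ * ξ) :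
    (charPoly β₁ β₀ ξ η).leadingCoeff = 1 - (β₀ : ℂ) * ξ := by
  rw [charPoly_eq_cubic]
  exact leadingCoeff_cubic (one_sub_mul_ne_zero h)

/-- A nonzero point is a root iff the real and imaginary parts of `P(z) * conj z ^ 2` vanish. -/
theorem isRoot_charPoly_iff {β₁ β₀ ξ η x y : ℝ} (h : x ^ 2 + y ^ 2 ≠ 0) :
    (charPoly β₁ β₀ ξ η).IsRoot ⟨x, y⟩ ↔
      (1 - β₀ * ξ) * x * (x ^ 2 + y ^ 2) ^ 2 - (3 / 4 + β₁ * ξ) * (x ^ 2 + y ^ 2) ^ 2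
        + ξ * (3 * β₀ + 2 * β₁ - 3) * x * (x ^ 2 + y ^ 2)
        - (1 / 4 + ξ * (2 * β₀ + β₁ - 3 / 2)) * (x ^ 2 - y ^ 2) = 0 ∧
      (1 - β₀ * ξ) * y * (x ^ 2 + y ^ 2) ^ 2 - 3 / 2 * η * (x ^ 2 + y ^ 2) ^ 2
        - ξ * (3 * β₀ + 2 * β₁ - 3) * y * (x ^ 2 + y ^ 2)
        + (1 / 4 + ξ * (2 * β₀ + β₁ - 3 / 2)) * (2 * x * y) = 0 := by
  have hz : (⟨x, -y⟩ : ℂ) ^ 2 ≠ 0 := by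
    refine pow_ne_zero _ fun h0 => h ?_
    have h1 := congrArg Complex.re h0
    have h2 := congrArg Complex.im h0
    simp only [Complex.zero_re, Complex.zero_im, neg_eq_zero] at h1 h2
    simp [h1, h2]
  have hI : Complex.I = ⟨0, 1⟩ := rfl
  have key : ∀ t : ℝ, (t : ℂ) = ⟨t, 0⟩ := fun t => rfl
  rw [IsRoot.def, ← mul_left_inj' hz, zero_mul, charPoly_eval]
  have e : ((1 - (β₀ : ℂ) * ξ) * (⟨x, y⟩ : ℂ) ^ 3
      - (3 / 4 + (β₁ : ℂ) * ξ + 3 * Complex.I * η / 2) * (⟨x, y⟩ : ℂ) ^ 2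
      + ((ξ : ℂ) * (3 * β₀ + 2 * β₁ - 3)) * (⟨x, y⟩ : ℂ)
      - (1 / 4 + 2 * (β₀ : ℂ) * ξ + β₁ * ξ - 3 / 2 * ξ)) * (⟨x, -y⟩ : ℂ) ^ 2 =
      (((1 - β₀ * ξ) * x * (x ^ 2 + y ^ 2) ^ 2 - (3 / 4 + β₁ * ξ) * (x ^ 2 + y ^ 2) ^ 2
        + ξ * (3 * β₀ + 2 * β₁ - 3) * x * (x ^ 2 + y ^ 2)
        - (1 / 4 + ξ * (2 * β₀ + β₁ - 3 / 2)) * (x ^ 2 - y ^ 2) : ℝ) : ℂ) +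
      (((1 - β₀ * ξ) * y * (x ^ 2 + y ^ 2) ^ 2 - 3 / 2 * η * (x ^ 2 + y ^ 2) ^ 2
        - ξ * (3 * β₀ + 2 * β₁ - 3) * y * (x ^ 2 + y ^ 2)
        + (1 / 4 + ξ * (2 * β₀ + β₁ - 3 / 2)) * (2 * x * y) : ℝ) : ℂ) * Complex.I := by
    have h1 : (⟨x, y⟩ : ℂ) = x + y * Complex.I := Complex.mk_eq_add_mul_I x y
    have h2 : (⟨x, -y⟩ : ℂ) = x - y * Complex.I := by
      rw [Complex.mk_eq_add_mul_I]; push_cast; ring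
    have h3 : (x + y * Complex.I) * (x - y * Complex.I) = ((x : ℂ) ^ 2 + y ^ 2) := by
      linear_combination (-(y : ℂ) ^ 2) * Complex.I_sq
    rw [h1, h2]
    push_cast
    rw [← h3]
    linear_combination ((1 / 4 + ξ * (2 * β₀ + β₁ - 3 / 2)) * (y : ℂ) ^ 2) *
      (-Complex.I_sq)
  rw [e, Complex.ext_iff]
  simp only [Complex.add_re, Complex.ofReal_re, Complex.re_ofReal_mul, Complex.I_re, mul_zero,
    add_zero, Complex.zero_re, Complex.add_im, Complex.ofReal_im, Complex.im_ofReal_mul,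
    Complex.I_im, mul_one, zero_add, Complex.zero_im]

/-- Points of the root locus curve are limits of unstable points: move the root on the unit
circle radially outwards. -/
theorem mem_closure_compl_stabilityRegion {β₁ β₀ ξ η c s : ℝ} (hcs : c ^ 2 + s ^ 2 = 1)
    (hroot : (charPoly β₁ β₀ ξ η).IsRoot ⟨c, s⟩)
    (hg : β₀ * c + β₁ + (3 - 3 * β₀ - 2 * β₁) * c
      + (2 * β₀ + β₁ - 3 / 2) * (c ^ 2 - s ^ 2) ≠ 0) :
    (ξ, η) ∈ closure (stabilityRegion β₁ β₀)ᶜ := by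
  -- `(X r, Y r)` is the parameter point having `r(c + i s)` as a root: the real equation is linear
  -- in `ξ` with coefficient `G r`, and the imaginary one then gives `η`.
  set G : ℝ → ℝ := fun r => β₀ * c * r + β₁ + (3 - 3 * β₀ - 2 * β₁) * c / r
      + (2 * β₀ + β₁ - 3 / 2) * (c ^ 2 - s ^ 2) / r ^ 2 with hG
  set X : ℝ → ℝ := fun r => (c * r - 3 / 4 - (c ^ 2 - s ^ 2) / (4 * r ^ 2)) / G r with hX
  set Y : ℝ → ℝ := fun r => 2 / 3 * ((1 - β₀ * X r) * s * r
      + X r * (3 - 3 * β₀ - 2 * β₁) * s / r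
      + (1 / 4 + X r * (2 * β₀ + β₁ - 3 / 2)) * (2 * c * s) / r ^ 2) with hY
  have hG1 : G 1 ≠ 0 := by simpa [hG] using hg
  have cG : ContinuousAt G 1 := by
    apply ContinuousAt.add
    · apply ContinuousAt.add
      · fun_prop
      · exact ContinuousAt.div (by fun_prop) (by fun_prop) one_ne_zero
    · exact ContinuousAt.div (by fun_prop) (by fun_prop) (by norm_num)
  have cX : ContinuousAt X 1 := by
    apply ContinuousAt.div _ cG hG1
    apply ContinuousAt.sub (by fun_prop)
    exact ContinuousAt.div (by fun_prop) (by fun_prop) (by norm_num)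
  have cY : ContinuousAt Y 1 := by
    apply ContinuousAt.mul (by fun_prop)
    apply ContinuousAt.add
    · apply ContinuousAt.add
      · fun_prop
      · exact ContinuousAt.div (by fun_prop) (by fun_prop) one_ne_zero
    · exact ContinuousAt.div (by fun_prop) (by fun_prop) (by norm_num)
  rw [isRoot_charPoly_iff (by rw [hcs]; norm_num), hcs] at hroot
  obtain ⟨h1, h2⟩ := hroot
  have eX : X 1 = ξ := by
    rw [hX]
    simp only
    rw [div_eq_iff hG1]
    simp only [hG]
    linarith
  have eY : Y 1 = η := by
    simp only [hY, eX]
    linarith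
  have ht : Tendsto (fun r => (X r, Y r)) (𝓝[>] 1) (𝓝 (ξ, η)) := by
    have : ContinuousAt (fun r => (X r, Y r)) 1 := cX.prodMk cY
    have := this.tendsto
    rw [eX, eY] at this
    exact this.mono_left nhdsWithin_le_nhds
  refine mem_closure_of_tendsto ht ?_
  have hGne : ∀ᶠ r in 𝓝[>] (1 : ℝ), G r ≠ 0 :=
    (cG.eventually_ne hG1).filter_mono nhdsWithin_le_nhds
  filter_upwards [hGne, self_mem_nhdsWithin] with r hGr hr
  have hr : 1 < r := hr
  have hr0 : r ≠ 0 := by positivity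
  rintro ⟨-, -, hS⟩
  have hn : (c * r) ^ 2 + (s * r) ^ 2 = r ^ 2 := by linear_combination r ^ 2 * hcs
  have hXe : X r * G r = c * r - 3 / 4 - (c ^ 2 - s ^ 2) / (4 * r ^ 2) := by
    simp only [hX]
    rw [div_mul_cancel₀ _ hGr]
  have hYe : Y r = 2 / 3 * ((1 - β₀ * X r) * s * r
      + X r * (3 - 3 * β₀ - 2 * β₁) * s / r
      + (1 / 4 + X r * (2 * β₀ + β₁ - 3 / 2)) * (2 * c * s) / r ^ 2) := rfl
  have hrt : (charPoly β₁ β₀ (X r) (Y r)).IsRoot ⟨c * r, s * r⟩ := by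
    rw [isRoot_charPoly_iff (by rw [hn]; positivity), hn]
    constructor
    · simp only [hG] at hXe
      generalize X r = ξ' at *
      field_simp at hXe
      linear_combination (-r ^ 2 / 8) * hXe
    · rw [hYe]
      generalize X r = ξ' at *
      field_simp
      ring
  have := (hS _ hrt).1
  have h3 : ‖(⟨c * r, s * r⟩ : ℂ)‖ ^ 2 = r ^ 2 := by
    rw [← Complex.normSq_eq_norm_sq, Complex.normSq_mk, ← hn]; ring
  nlinarith [norm_nonneg (⟨c * r, s * r⟩ : ℂ)]

/-- The root locus curve in the wedge coordinates `u = β₃` and `v = 9 / 2 - 4 * β₀ - 4 * β₁`. -/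
theorem isRoot_charPoly_of_locus {u v q η c s : ℝ} (hcs : c ^ 2 + s ^ 2 = 1)
    (hq : (1 - c) ^ 2
      = 2 * q * (3 / 4 * (1 + c) - v * (1 - c) / 2 - 2 * u * (1 - c) * (1 + c)))
    (hη : η = 2 / 3 * s * (1 + c / 2 + 2 * q * u * (1 - c))) :
    (charPoly (3 / 4 - u - v / 2) (u + 3 / 8 + v / 4) (-q) η).IsRoot ⟨c, s⟩ := by
  have hs : s ^ 2 = 1 - c ^ 2 := by linarith
  rw [isRoot_charPoly_iff (by rw [hcs]; norm_num), hcs, hs, hη]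
  constructor
  · linear_combination (-1 / 2) * hq
  · ring

/-! ### Necessity: locus points inside the parabola -/

theorem exists_root_of_pos_of_neg {f : ℝ → ℝ} {a b : ℝ} (hab : a < b) (hf : Continuous f)
    (ha : 0 < f a) (hb : f b < 0) : ∃ c, a < c ∧ c < b ∧ f c = 0 := by
  obtain ⟨c, hc, h⟩ := intermediate_value_Ioo' hab.le hf.continuousOn ⟨hb, ha⟩
  exact ⟨c, hc.1, hc.2, h⟩

/-- The cosine at which, for given wedge coordinates with `u > 0`, the locus is best compared
with the parabola. -/
theorem exists_critical_cosine {u v : ℝ} (hu : 0 < u) (hv : 0 ≤ v) :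
    ∃ c : ℝ, -1 / 5 < c ∧ c < 1 ∧ 0 < 3 * (1 + c) - 2 * v * (1 - c) ∧
      (3 * (1 + c) - 2 * v * (1 - c)) * (1 - c) ^ 2
        = (1 + 5 * c) * (3 * (1 + c) - 2 * v * (1 - c) - 8 * u * (1 - c) * (1 + c)) := by
  set f : ℝ → ℝ := fun c => (3 * (1 + c) - 2 * v * (1 - c)) * (1 - c) ^ 2
    - (1 + 5 * c) * (3 * (1 + c) - 2 * v * (1 - c) - 8 * u * (1 - c) * (1 + c)) with hf
  have hfc : Continuous f := by fun_prop
  have hf1 : f 1 < 0 := by simp only [hf]; norm_num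
  -- At `c = -1/5` the factor `b = 3(1+c) - 2v(1-c)` equals `12(1-v)/5`. For `v > 1` the search
  -- therefore starts at the zero of `b`; for `v = 1`, `b = 1 + 5c` divides the equation.
  rcases lt_trichotomy v 1 with h | h | h
  · obtain ⟨c, h1, h2, h3⟩ := exists_root_of_pos_of_neg (a := -1 / 5) (b := 1)
      (by norm_num) hfc (by simp only [hf]; nlinarith) hf1
    exact ⟨c, h1, h2, by nlinarith, sub_eq_zero.1 h3⟩
  · subst h
    obtain ⟨c, h1, h2, h3⟩ := exists_root_of_pos_of_neg
      (f := fun c : ℝ => (1 - c) ^ 2 - (1 + 5 * c) + 8 * u * (1 - c) * (1 + c))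
      (a := -1 / 5) (b := 1) (by norm_num) (by fun_prop) (by nlinarith) (by norm_num)
    refine ⟨c, h1, h2, by linarith, ?_⟩
    linear_combination (1 + 5 * c) * h3
  · have hd : 0 < 2 * v + 3 := by linarith
    have hl : (3 : ℝ) * (1 + (2 * v - 3) / (2 * v + 3))
        - 2 * v * (1 - (2 * v - 3) / (2 * v + 3)) = 0 := by
      field_simp; ring
    have hl1 : (2 * v - 3) / (2 * v + 3) < 1 := by rw [div_lt_one hd]; linarith
    have hl2 : -1 / 5 < (2 * v - 3) / (2 * v + 3) := by
      rw [div_lt_div_iff₀ (by norm_num) hd]; linarith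
    have hfl : 0 < f ((2 * v - 3) / (2 * v + 3)) := by
      simp only [hf, hl]
      generalize (2 * v - 3) / (2 * v + 3) = l at *
      have : 0 < (1 + 5 * l) * (8 * u * (1 - l) * (1 + l)) :=
        mul_pos (by linarith) (mul_pos (mul_pos (by linarith) (by linarith)) (by linarith))
      linarith
    obtain ⟨c, h1, h2, h3⟩ := exists_root_of_pos_of_neg hl1 hfc hfl hf1
    refine ⟨c, by linarith, h2, ?_, sub_eq_zero.1 h3⟩
    generalize (2 * v - 3) / (2 * v + 3) = l at *
    nlinarith

/-- For every wedge parameter other than the optimal one, the locus enters the interior of the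
parabola `η² ≤ (6/5) |ξ|`. -/
theorem exists_locus_point {u v : ℝ} (hu : 0 ≤ u) (hv : 0 ≤ v) (huv : ¬ (u = 11 / 20 ∧ v = 0)) :
    ∃ c s q η : ℝ, c ^ 2 + s ^ 2 = 1 ∧ 0 < q ∧
      0 < 3 / 4 * (1 + c) - v * (1 - c) / 2 - 2 * u * (1 - c) * (1 + c) ∧
      (1 - c) ^ 2
        = 2 * q * (3 / 4 * (1 + c) - v * (1 - c) / 2 - 2 * u * (1 - c) * (1 + c)) ∧
      η = 2 / 3 * s * (1 + c / 2 + 2 * q * u * (1 - c)) ∧ η ^ 2 < 6 / 5 * q := by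
  -- For `u = 0` a critical cosine with `b > 0` may fail to exist. The choice `q = 2(1-c)` makes the
  -- locus equation linear in `c` and leaves `η² ≤ q`.
  rcases hu.eq_or_lt with rfl | hu
  · have hd : 0 < v + 2 := by linarith
    obtain ⟨c, hc⟩ : ∃ c : ℝ, c * (v + 2) = v - 1 := ⟨(v - 1) / (v + 2), by field_simp⟩
    have hc1 : c < 1 := by nlinarith
    have hc2 : -1 < c := by nlinarith
    have hs : √(1 - c ^ 2) ^ 2 = 1 - c ^ 2 := Real.sq_sqrt (by nlinarith)
    refine ⟨c, √(1 - c ^ 2), 2 * (1 - c), _, by rw [hs]; ring, by linarith, by nlinarith, ?_,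
      rfl, ?_⟩
    · linear_combination (-2) * (1 - c) * hc
    · have : (2 / 3 * √(1 - c ^ 2) * (1 + c / 2 + 2 * (2 * (1 - c)) * 0 * (1 - c))) ^ 2
          = (1 - c) * ((1 + c) * (2 / 3 * (1 + c / 2)) ^ 2) := by
        linear_combination 4 / 9 * (1 + c / 2) ^ 2 * hs
      rw [this]
      have h1 : (2 / 3 * (1 + c / 2)) ^ 2 ≤ 1 := by nlinarith
      have h2 : (1 + c) * (2 / 3 * (1 + c / 2)) ^ 2 ≤ 2 := by nlinarith
      nlinarith
  · obtain ⟨c, hc1, hc2, hb, hf⟩ := exists_critical_cosine hu hv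
    have hs : √(1 - c ^ 2) ^ 2 = 1 - c ^ 2 := Real.sq_sqrt (by nlinarith)
    have hb3 : 3 * (1 + c) - 2 * v * (1 - c) ≤ 3 * (1 + c) := by
      have := mul_nonneg hv (sub_nonneg.2 hc2.le)
      linarith
    have hstrict : 5 * (1 - c) * (1 + 5 * c) * (3 * (1 + c) - 2 * v * (1 - c))
        < 27 * (1 + c) := by
      by_cases hc : c = 2 / 5
      · subst hc
        have hv' : 0 < v := by
          refine lt_of_le_of_ne hv fun hv0 => huv ⟨?_, hv0.symm⟩
          subst hv0
          linarith
        linarith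
      · have h1 : 0 < (5 * c - 2) ^ 2 := by
          have : 5 * c - 2 ≠ 0 := fun h => hc (by linarith)
          positivity
        have h2 : 5 * (1 - c) * (1 + 5 * c) < 9 := by nlinarith
        nlinarith
    set b := 3 * (1 + c) - 2 * v * (1 - c) with hbdef
    have h5 : 0 < 1 + 5 * c := by linarith
    have h1c : 0 < 1 + c := by linarith
    have hg : 3 / 4 * (1 + c) - v * (1 - c) / 2 - 2 * u * (1 - c) * (1 + c)
        = b * (1 - c) ^ 2 / (1 + 5 * c) / 4 := by
      rw [eq_div_iff (by norm_num), eq_div_iff h5.ne', hf, hbdef]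
      ring
    clear_value b
    have hη : 1 + c / 2 + 2 * (2 * (1 + 5 * c) / b) * u * (1 - c) = (1 + 5 * c) / (1 + c) := by
      field_simp
      linear_combination hf
    -- This `q` is the equality case `qb/2 = 1 + 5c` of AM-GM.
    refine ⟨c, √(1 - c ^ 2), 2 * (1 + 5 * c) / b, _, by rw [hs]; ring, by positivity, ?_, ?_,
      rfl, ?_⟩
    · rw [hg]
      have : 0 < (1 - c) ^ 2 := pow_pos (by linarith) 2
      positivity
    · rw [hg]
      calc (1 - c) ^ 2 = (1 - c) ^ 2 * (b / b) * ((1 + 5 * c) / (1 + 5 * c)) := by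
            rw [div_self hb.ne', div_self h5.ne', mul_one, mul_one]
        _ = _ := by ring
    · rw [hη, mul_pow, mul_pow, hs]
      have : (2 / 3) ^ 2 * (1 - c ^ 2) * ((1 + 5 * c) / (1 + c)) ^ 2
          = 4 / 9 * (1 - c) * (1 + 5 * c) ^ 2 / (1 + c) := by
        field_simp
        ring
      rw [this, div_lt_iff₀ h1c, mul_comm, ← mul_assoc]
      have h6 : 6 / 5 * (2 * (1 + 5 * c) / b) * (1 + c)
          = (12 / 5 * (1 + 5 * c) * (1 + c)) / b := by ring
      rw [mul_comm ((1 + 5 * c) ^ 2), h6, lt_div_iff₀ hb]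
      nlinarith [mul_lt_mul_of_pos_left hstrict h5]

theorem mem_interior_parabola {m ξ η : ℝ} (hξ : ξ < 0) (hη : η ^ 2 < m * |ξ|) :
    (ξ, η) ∈ interior (parabola m) := by
  refine mem_interior.2 ⟨{p : ℝ × ℝ | p.1 < 0 ∧ p.2 ^ 2 < m * |p.1|}, fun p hp => ⟨hp.1.le, hp.2.le⟩, ?_,
    hξ, hη⟩
  exact (isOpen_lt continuous_fst continuous_const).inter
    (isOpen_lt (f := fun p : ℝ × ℝ => p.2 ^ 2) (g := fun p : ℝ × ℝ => m * |p.1|)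
      (by fun_prop) (by fun_prop))

theorem not_parabola_subset {m u v c s q η : ℝ} (hcs : c ^ 2 + s ^ 2 = 1) (hq0 : 0 < q)
    (hg : 0 < 3 / 4 * (1 + c) - v * (1 - c) / 2 - 2 * u * (1 - c) * (1 + c))
    (hq : (1 - c) ^ 2
      = 2 * q * (3 / 4 * (1 + c) - v * (1 - c) / 2 - 2 * u * (1 - c) * (1 + c)))
    (hη : η = 2 / 3 * s * (1 + c / 2 + 2 * q * u * (1 - c))) (hlt : η ^ 2 < m * q) :
    ¬ parabola m ⊆ stabilityRegion (3 / 4 - u - v / 2) (u + 3 / 8 + v / 4) := by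
  intro hsub
  have h1 := mem_closure_compl_stabilityRegion hcs (isRoot_charPoly_of_locus hcs hq hη) (by
    have hs : s ^ 2 = 1 - c ^ 2 := by linarith
    rw [hs]
    intro h0
    apply hg.ne'
    linear_combination h0)
  rw [closure_compl] at h1
  refine h1 (interior_mono hsub (mem_interior_parabola (by linarith) ?_))
  rwa [abs_neg, abs_of_pos hq0]

theorem eq_of_parabola_subset {β : ℝ × ℝ} (hβ : β ∈ W)
    (h : parabola (6 / 5) ⊆ stabilityRegion β.1 β.2) : β = (1 / 5, 37 / 40) := by
  obtain ⟨β₁, β₀⟩ := β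
  obtain ⟨h1, h2, h3⟩ := hβ
  simp only at h h1 h2 h3
  by_contra hne
  have huv : ¬ (2 * β₀ + β₁ - 3 / 2 = 11 / 20 ∧ 9 / 2 - 4 * β₀ - 4 * β₁ = 0) := by
    rintro ⟨e1, e2⟩
    apply hne
    rw [Prod.mk.injEq]
    constructor <;> linarith
  obtain ⟨c, s, q, η, hcs, hq0, hg, hq, hη, hlt⟩ :=
    exists_locus_point (by linarith) (by linarith) huv
  have := not_parabola_subset hcs hq0 hg hq hη hlt
  ring_nf at this h
  exact this h

/-! ### Strict stability: openness and limits -/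

/-- The points with `ξ < 0` at which all characteristic roots lie in the open unit disk. -/
def strictRegion (β₁ β₀ : ℝ) : Set (ℝ × ℝ) :=
  {p | p.1 < 0 ∧ ∀ z, (charPoly β₁ β₀ p.1 p.2).IsRoot z → ‖z‖ < 1}

theorem one_sub_mul_pos {β₀ ξ : ℝ} (hβ : 0 ≤ β₀) (hξ : ξ ≤ 0) : 0 < 1 - β₀ * ξ := by
  have := mul_nonneg hβ (neg_nonneg.2 hξ)
  linarith

theorem strictRegion_subset {β₁ β₀ : ℝ} (hβ : 0 ≤ β₀) :
    strictRegion β₁ β₀ ⊆ stabilityRegion β₁ β₀ := by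
  rintro p ⟨hp, h⟩
  refine ⟨hp.le, ?_, fun z hz => ⟨(h z hz).le, fun h1 => absurd h1 (h z hz).ne⟩⟩
  rw [natDegree_charPoly (one_sub_mul_pos hβ hp.le)]
  norm_num

theorem isOpen_strictRegion {β₁ β₀ : ℝ} (hβ : 0 ≤ β₀) : IsOpen (strictRegion β₁ β₀) := by
  -- The reversed polynomial in `w = 1/z` turns the non-compact condition on `|z| ≥ 1` into
  -- non-vanishing on the compact unit disk; at `w = 0` it is the leading coefficient.
  set R : (ℝ × ℝ) → ℂ → ℂ := fun p w => (1 - (β₀ : ℂ) * p.1)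
      - (3 / 4 + (β₁ : ℂ) * p.1 + 3 * Complex.I * p.2 / 2) * w
      + ((p.1 : ℂ) * (3 * β₀ + 2 * β₁ - 3)) * w ^ 2
      - (1 / 4 + 2 * (β₀ : ℂ) * p.1 + β₁ * p.1 - 3 / 2 * p.1) * w ^ 3 with hR
  have hev : ∀ p : ℝ × ℝ, ∀ z : ℂ, z ≠ 0 →
      (charPoly β₁ β₀ p.1 p.2).eval z = z ^ 3 * R p z⁻¹ := by
    intro p z hz
    rw [charPoly_eval]
    simp only [hR]
    field_simp
  have hcont : Continuous fun x : (ℝ × ℝ) × ℂ => R x.1 x.2 := by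
    simp only [hR]
    fun_prop
  rw [isOpen_iff_mem_nhds]
  rintro p ⟨hp, h⟩
  have h1 : ∀ᶠ x in 𝓝 p, ∀ w ∈ Metric.closedBall (0 : ℂ) 1, R x w ≠ 0 := by
    refine (isCompact_closedBall (0 : ℂ) 1).eventually_forall_of_forall_eventually
      fun w hw => ?_
    refine (hcont.continuousAt (x := (p, w))).eventually_ne ?_
    by_cases hw0 : w = 0
    · subst hw0
      simpa [hR] using one_sub_mul_ne_zero (one_sub_mul_pos hβ hp.le)
    · intro h0
      have := h w⁻¹ (by rw [IsRoot.def, hev p _ (inv_ne_zero hw0), inv_inv, h0, mul_zero])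
      rw [norm_inv, inv_lt_one₀ (norm_pos_iff.2 hw0)] at this
      rw [mem_closedBall_zero_iff] at hw
      linarith
  have h2 : ∀ᶠ x : ℝ × ℝ in 𝓝 p, x.1 < 0 := (isOpen_lt continuous_fst continuous_const).mem_nhds hp
  filter_upwards [h1, h2] with x hx1 hx2
  refine ⟨hx2, fun z hz => ?_⟩
  by_contra! hz1
  have hz0 : z ≠ 0 := by rw [← norm_pos_iff]; linarith
  rw [IsRoot.def, hev x z hz0] at hz
  refine hx1 z⁻¹ ?_ ((mul_eq_zero.1 hz).resolve_left (pow_ne_zero _ hz0))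
  rw [mem_closedBall_zero_iff, norm_inv]
  exact inv_le_one_of_one_le₀ hz1

/-- Each linear factor satisfies `|z - x| ≥ |z| - 1`. The bound survives limits of polynomials, so
no root can jump outside the disk. -/
theorem norm_leadingCoeff_mul_pow_le_norm_eval {Q : ℂ[X]} (hQ : ∀ z, Q.IsRoot z → ‖z‖ ≤ 1)
    {z : ℂ} (hz : 1 ≤ ‖z‖) :
    ‖Q.leadingCoeff‖ * (‖z‖ - 1) ^ Q.natDegree ≤ ‖Q.eval z‖ := by
  have hs := IsAlgClosed.splits Q
  have aux : ∀ M : Multiset ℂ, (∀ x ∈ M, ‖x‖ ≤ 1) →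
      (‖z‖ - 1) ^ Multiset.card M ≤ ‖(M.map fun x => z - x).prod‖ := by
    intro M
    induction M using Multiset.induction with
    | empty => intro _; simp
    | cons a M ih =>
      intro hM
      rw [Multiset.card_cons, pow_succ', Multiset.map_cons, Multiset.prod_cons, norm_mul]
      have h1 := ih fun x hx => hM x (Multiset.mem_cons_of_mem hx)
      have h2 := hM a (Multiset.mem_cons_self a M)
      have h3 := norm_sub_norm_le z a
      exact mul_le_mul (by linarith) h1 (pow_nonneg (by linarith) _) (norm_nonneg _)
  by_cases h0 : Q = 0
  · simp [h0]
  have h1 := aux Q.roots fun x hx => hQ x ((mem_roots h0).1 hx)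
  rw [← hs.natDegree_eq_card_roots] at h1
  have h2 : Q.eval z = Q.leadingCoeff * (Q.roots.map fun x => z - x).prod := by
    conv_lhs => rw [hs.eq_prod_roots]
    simp [eval_multiset_prod]
  rw [h2, norm_mul]
  gcongr

/-- Limits of strictly stable points have all roots in the closed unit disk. -/
theorem norm_le_one_of_mem_closure {β₁ β₀ : ℝ} (hβ : 0 ≤ β₀) {p : ℝ × ℝ}
    (hp : p ∈ closure (strictRegion β₁ β₀)) {z : ℂ}
    (hz : (charPoly β₁ β₀ p.1 p.2).IsRoot z) : ‖z‖ ≤ 1 := by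
  by_contra! hz1
  have hcl : IsClosed {x : ℝ × ℝ | (‖z‖ - 1) ^ 3 ≤ ‖(charPoly β₁ β₀ x.1 x.2).eval z‖} := by
    simp only [charPoly_eval]
    exact isClosed_le continuous_const (by fun_prop)
  have hsub : strictRegion β₁ β₀ ⊆
      {x : ℝ × ℝ | (‖z‖ - 1) ^ 3 ≤ ‖(charPoly β₁ β₀ x.1 x.2).eval z‖} := by
    rintro x ⟨hx, h⟩
    have h1 := norm_leadingCoeff_mul_pow_le_norm_eval (fun w hw => (h w hw).le) hz1.le
    have h2 := one_sub_mul_pos hβ hx.le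
    rw [leadingCoeff_charPoly h2, natDegree_charPoly h2] at h1
    refine le_trans ?_ h1
    have h3 : ‖(1 - (β₀ : ℂ) * x.1)‖ = 1 - β₀ * x.1 := by
      rw [← abs_of_pos h2, ← Real.norm_eq_abs, ← Complex.norm_real]
      push_cast
      rfl
    rw [h3]
    have h4 : 0 ≤ (‖z‖ - 1) ^ 3 := pow_nonneg (by linarith) _
    nlinarith [mul_nonneg hβ (neg_nonneg.2 hx.le)]
  have := closure_minimal hsub hcl hp
  simp only [mem_ofPred_eq, hz.eq_zero, norm_zero] at this
  have : 0 < (‖z‖ - 1) ^ 3 := pow_pos (by linarith) _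
  linarith

/-! ### Sufficiency: the optimal pair -/

/-- For the optimal parameters, a root on the unit circle forces `η² ≥ (6/5) |ξ|`, with equality
only at the origin and at the tangency points. -/
theorem locus_optimal {q η c s : ℝ} (hq : 0 ≤ q) (hcs : c ^ 2 + s ^ 2 = 1)
    (hroot : (charPoly (1 / 5) (37 / 40) (-q) η).IsRoot ⟨c, s⟩) (hle : η ^ 2 ≤ 6 / 5 * q) :
    q = 0 ∨ (q = 10 / 7 ∧ η ^ 2 = 6 / 5 * q) := by
  rw [isRoot_charPoly_iff (by rw [hcs]; norm_num), hcs] at hroot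
  obtain ⟨h1, h2⟩ := hroot
  have hs : s ^ 2 = 1 - c ^ 2 := by linarith
  rw [hs] at h1
  rcases hq.eq_or_lt with h0 | hq0
  · exact Or.inl h0.symm
  right
  have e1 : 10 * (1 - c) ^ 2 = q * ((1 + c) * (22 * c - 7)) := by linear_combination (-20) * h1
  have e2 : 3 / 2 * η = s * (1 + c / 2 + 11 / 10 * q * (1 - c)) := by linear_combination -h2
  have hcl : -1 ≤ c := by nlinarith [sq_nonneg s]
  have hcu : c ≤ 1 := by nlinarith [sq_nonneg s]
  have hc1 : c < 1 := by
    refine lt_of_le_of_ne hcu fun h => ?_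
    subst h
    linarith
  have hc2 : 0 < 1 + c := by
    refine lt_of_le_of_ne (by linarith) fun h => ?_
    rw [← h] at e1
    have : c = -1 := by linarith
    subst this
    norm_num at e1
  have hk : 0 < 22 * c - 7 := by
    by_contra! hk
    have h3 : (1 + c) * (22 * c - 7) ≤ 0 := mul_nonpos_of_nonneg_of_nonpos hc2.le hk
    have h4 : 0 < (1 - c) ^ 2 := pow_pos (by linarith) 2
    nlinarith
  have e3 : (1 + c / 2 + 11 / 10 * q * (1 - c)) * (2 * (1 + c) * (22 * c - 7))
      = 125 * c ^ 2 - 43 * c + 8 := by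
    linear_combination (-22 / 10) * (1 - c) * e1
  have e4 : 3 * η * ((1 + c) * (22 * c - 7)) = s * (125 * c ^ 2 - 43 * c + 8) := by
    linear_combination 2 * (1 + c) * (22 * c - 7) * e2 + s * e3
  have e5 : 9 * η ^ 2 * ((1 + c) * (22 * c - 7) ^ 2)
      = (1 - c) * (125 * c ^ 2 - 43 * c + 8) ^ 2 := by
    have h3 : (3 * η * ((1 + c) * (22 * c - 7))) ^ 2
        = (1 - c ^ 2) * (125 * c ^ 2 - 43 * c + 8) ^ 2 := by rw [e4, mul_pow, hs]
    apply mul_left_cancel₀ hc2.ne'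
    linear_combination h3
  have h6 : 9 * η ^ 2 * ((1 + c) * (22 * c - 7) ^ 2)
      ≤ 9 * (6 / 5 * q) * ((1 + c) * (22 * c - 7) ^ 2) := by gcongr
  -- The double zero at `c = 2/5` is the tangency of locus and parabola.
  have h7 : (1 - c) * ((5 * c - 2) ^ 2 * (625 * c ^ 2 + 70 * c + 205)) ≤ 0 := by
    have h8 : 9 * (6 / 5 * q) * ((1 + c) * (22 * c - 7) ^ 2)
        = 108 * (1 - c) ^ 2 * (22 * c - 7) := by
      linear_combination (-54 / 5) * (22 * c - 7) * e1
    linear_combination h6 - e5 + h8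
  have h9 : 0 < 625 * c ^ 2 + 70 * c + 205 := by nlinarith
  have hc : c = 2 / 5 := by
    by_contra hne
    have : 5 * c - 2 ≠ 0 := fun h => hne (by linarith)
    have : 0 < (1 - c) * ((5 * c - 2) ^ 2 * (625 * c ^ 2 + 70 * c + 205)) :=
      mul_pos (by linarith) (by positivity)
    linarith
  subst hc
  constructor <;> linarith

theorem rootMultiplicity_optimal {q η : ℝ} (hq : q = 0 ∨ q = 10 / 7)
    {z : ℂ} (hz : ‖z‖ = 1) (hroot : (charPoly (1 / 5) (37 / 40) (-q) η).IsRoot z) :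
    (charPoly (1 / 5) (37 / 40) (-q) η).rootMultiplicity z = 1 := by
  have hpos : 0 < 1 - (37 / 40 : ℝ) * (-q) := by rcases hq with rfl | rfl <;> norm_num
  have h0 : charPoly (1 / 5) (37 / 40) (-q) η ≠ 0 := by
    intro h
    have := natDegree_charPoly (β₁ := 1 / 5) (η := η) hpos
    rw [h, natDegree_zero] at this
    omega
  refine le_antisymm ?_ ((rootMultiplicity_pos h0).2 hroot)
  by_contra! h1
  obtain ⟨-, h2⟩ := (one_lt_rootMultiplicity_iff_isRoot h0).1 h1
  rw [IsRoot.def, charPoly_eval] at hroot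
  have h3 : (charPoly (1 / 5) (37 / 40) (-q) η).derivative.eval z
      = 3 * (1 + 37 / 40 * (q : ℂ)) * z ^ 2
        - 2 * (3 / 4 - 1 / 5 * (q : ℂ) + 3 * Complex.I * η / 2) * z - 7 / 40 * q := by
    simp [charPoly]
    ring
  rw [IsRoot.def, h3] at h2
  -- `z P' - 2P` cancels the quadratic term, the only one containing `η`; for these two `q` the
  -- triangle inequality on `|z| = 1` then fails.
  have e : (1 + 37 / 40 * (q : ℂ)) * z ^ 3 = (-7 / 40 * q) * z + (11 / 10 * q - 1 / 2) := by
    push_cast at hroot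
    linear_combination z * h2 - 2 * hroot
  have e1 : ‖(1 + 37 / 40 * (q : ℂ))‖ ≤ ‖(-7 / 40 * q : ℂ)‖ + ‖(11 / 10 * q - 1 / 2 : ℂ)‖ := by
    have := norm_add_le ((-7 / 40 * q : ℂ) * z) (11 / 10 * q - 1 / 2)
    rw [← e] at this
    simpa only [norm_mul, norm_pow, hz, one_pow, mul_one] using this
  have e2 : ∀ x : ℝ, ‖(x : ℂ)‖ = |x| := fun x => by rw [Complex.norm_real, Real.norm_eq_abs]
  have e3 := e2 (1 + 37 / 40 * q)
  have e4 := e2 (-7 / 40 * q)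
  have e5 := e2 (11 / 10 * q - 1 / 2)
  push_cast at e3 e4 e5
  rw [e3, e4, e5] at e1
  rcases hq with rfl | rfl <;> norm_num [abs_of_pos, abs_of_neg] at e1

theorem mem_strictRegion_optimal {ξ η : ℝ} (hξ : ξ < 0) (hη : η ^ 2 < 6 / 5 * |ξ|) :
    (ξ, η) ∈ strictRegion (1 / 5) (37 / 40) := by
  set D : Set (ℝ × ℝ) := {p | p.1 < 0 ∧ p.2 ^ 2 < 6 / 5 * -p.1} with hD
  have hconv : Convex ℝ D := by
    have h2 : ConvexOn ℝ univ fun p : ℝ × ℝ => p.2 ^ 2 + 6 / 5 * p.1 := by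
      apply ConvexOn.add
      · exact (even_two.convexOn_pow (𝕜 := ℝ)).comp_linearMap (LinearMap.snd ℝ ℝ ℝ)
      · exact ((convexOn_id (𝕜 := ℝ) convex_univ).comp_linearMap
          (LinearMap.fst ℝ ℝ ℝ)).smul (by norm_num)
    have h3 := (convex_halfSpace_lt (LinearMap.fst ℝ ℝ ℝ).isLinear (0 : ℝ)).inter
      (h2.convex_lt 0)
    have h4 : D = {w | LinearMap.fst ℝ ℝ ℝ w < 0} ∩
        {x | x ∈ univ ∧ x.2 ^ 2 + 6 / 5 * x.1 < 0} :=
      Set.ext fun p => ⟨fun ⟨a, b⟩ => ⟨a, trivial, by linarith⟩,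
        fun ⟨a, _, b⟩ => ⟨a, by linarith⟩⟩
    rw [h4]
    exact h3
  have hsub : D ⊆ strictRegion (1 / 5) (37 / 40) := by
    -- The strict region is open, and relatively closed in `D` because `D` contains no locus point.
    refine hconv.isPreconnected.subset_of_closure_inter_subset
      (isOpen_strictRegion (by norm_num)) ?_ ?_
    · refine ⟨(-1, 0), by simp [hD], by norm_num, fun z hz => ?_⟩
      by_contra! h1
      rw [IsRoot.def, charPoly_eval] at hz
      have e : (77 / 40 : ℂ) * z ^ 3 = 11 / 20 * z ^ 2 + 7 / 40 * z + (-3 / 10) := by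
        push_cast at hz
        linear_combination hz
      have e1 : 77 / 40 * ‖z‖ ^ 3 ≤ 11 / 20 * ‖z‖ ^ 2 + 7 / 40 * ‖z‖ + 3 / 10 := by
        calc 77 / 40 * ‖z‖ ^ 3 = ‖(77 / 40 : ℂ) * z ^ 3‖ := by simp
          _ ≤ ‖(11 / 20 : ℂ) * z ^ 2‖ + ‖(7 / 40 : ℂ) * z‖ + ‖(-3 / 10 : ℂ)‖ := by
            rw [e]; exact norm_add₃_le
          _ = _ := by simp
      nlinarith [pow_le_pow_left₀ zero_le_one h1 2, mul_nonneg (sq_nonneg ‖z‖) (sub_nonneg.2 h1)]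
    · rintro p ⟨hp, hpD⟩
      refine ⟨hpD.1, fun z hz => lt_of_le_of_ne
        (norm_le_one_of_mem_closure (by norm_num) hp hz) fun h1 => ?_⟩
      obtain ⟨c, s⟩ := z
      have hcs : c ^ 2 + s ^ 2 = 1 := by
        have h3 : ‖(⟨c, s⟩ : ℂ)‖ ^ 2 = 1 := by rw [h1]; norm_num
        rw [← Complex.normSq_eq_norm_sq, Complex.normSq_mk] at h3
        linarith
      obtain ⟨p1, p2⟩ := p
      obtain ⟨hp1, hp2⟩ := hpD
      simp only at hp1 hp2 hz
      rw [← neg_neg p1] at hz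
      rcases locus_optimal (by linarith) hcs hz hp2.le with h | h <;> linarith
  exact hsub ⟨hξ, by rwa [abs_of_neg hξ] at hη⟩

theorem sq_add_sq_of_norm_eq_one {c s : ℝ} (h : ‖(⟨c, s⟩ : ℂ)‖ = 1) : c ^ 2 + s ^ 2 = 1 := by
  have h1 : ‖(⟨c, s⟩ : ℂ)‖ ^ 2 = 1 := by rw [h]; norm_num
  rw [← Complex.normSq_eq_norm_sq, Complex.normSq_mk] at h1
  linarith

theorem parabola_subset_stabilityRegion :
    parabola (6 / 5) ⊆ stabilityRegion (1 / 5) (37 / 40) := by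
  rintro ⟨ξ, η⟩ ⟨hξ, hη⟩
  simp only at hξ hη
  rw [abs_of_nonpos hξ] at hη
  have hcl : (ξ, η) ∈ closure (strictRegion (1 / 5) (37 / 40)) := by
    have ht : Tendsto (fun ε : ℝ => (ξ - ε, η)) (𝓝[>] 0) (𝓝 (ξ, η)) := by
      have : Continuous fun ε : ℝ => (ξ - ε, η) := by fun_prop
      have h := this.tendsto 0
      rw [sub_zero] at h
      exact h.mono_left nhdsWithin_le_nhds
    refine mem_closure_of_tendsto ht ?_
    filter_upwards [self_mem_nhdsWithin] with ε hε
    have hε : 0 < ε := hε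
    refine mem_strictRegion_optimal (by linarith) ?_
    rw [abs_of_neg (by linarith)]
    linarith
  refine ⟨hξ, ?_, fun z hz => ⟨norm_le_one_of_mem_closure (by norm_num) hcl hz, fun h1 => ?_⟩⟩
  · rw [natDegree_charPoly (one_sub_mul_pos (by norm_num) hξ)]
    norm_num
  · simp only at hz ⊢
    rw [← neg_neg ξ] at hz ⊢
    refine rootMultiplicity_optimal ?_ h1 hz
    obtain ⟨c, s⟩ := z
    exact (locus_optimal (by linarith) (sq_add_sq_of_norm_eq_one h1) hz hη).imp_right And.left

/-! ### Maximality of 6/5 and the tangency point -/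

theorem optimal_mem_W : ((1 / 5, 37 / 40) : ℝ × ℝ) ∈ W := by
  norm_num [W]

theorem tangency_locus {η : ℝ} (hη : η ^ 2 = 12 / 7) :
    ∃ s : ℝ, (2 / 5 : ℝ) ^ 2 + s ^ 2 = 1 ∧
      η = 2 / 3 * s * (1 + (2 / 5) / 2 + 2 * (10 / 7) * (11 / 20) * (1 - 2 / 5)) :=
  ⟨η * (7 / 10), by linear_combination 49 / 100 * hη, by ring⟩

theorem le_of_parabola_subset {m : ℝ} {β : ℝ × ℝ} (hβ : β ∈ W)
    (h : parabola m ⊆ stabilityRegion β.1 β.2) : m ≤ 6 / 5 := by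
  by_contra! hm
  have hsub : parabola (6 / 5) ⊆ parabola m := fun p hp =>
    ⟨hp.1, hp.2.trans (by gcongr)⟩
  obtain rfl := eq_of_parabola_subset hβ (hsub.trans h)
  have hη : √(12 / 7 : ℝ) ^ 2 = 12 / 7 := Real.sq_sqrt (by norm_num)
  obtain ⟨s, hs, he⟩ := tangency_locus hη
  -- For `m > 6/5` the tangency point of the optimal locus is interior to the larger parabola.
  refine not_parabola_subset (m := m) (u := 11 / 20) (v := 0) (q := 10 / 7) hs (by norm_num)
    (by norm_num) (by norm_num) he (by rw [hη]; linarith) ?_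
  norm_num at h ⊢
  exact h

theorem frontier_inter_frontier :
    frontier (parabola (6 / 5)) ∩ frontier (stabilityRegion (1 / 5) (37 / 40)) ∩
        {p : ℝ × ℝ | p.1 < 0 ∧ 0 < p.2} =
      {(-10 / 7, 2 * √(3 / 7))} := by
  have hsq : (2 * √(3 / 7 : ℝ)) ^ 2 = 12 / 7 := by
    rw [mul_pow, Real.sq_sqrt (by norm_num)]; norm_num
  have hpos : 0 < 2 * √(3 / 7 : ℝ) := by positivity
  have hclosed : IsClosed (parabola (6 / 5)) :=
    (isClosed_le continuous_fst continuous_const).inter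
      (isClosed_le (f := fun p : ℝ × ℝ => p.2 ^ 2) (g := fun p : ℝ × ℝ => 6 / 5 * |p.1|)
        (by fun_prop) (by fun_prop))
  apply Set.ext
  rintro ⟨ξ, η⟩
  rw [mem_singleton_iff, Prod.mk.injEq]
  constructor
  · rintro ⟨⟨hP, hS⟩, hξ, hη⟩
    simp only at hξ hη
    have hmem : (ξ, η) ∈ parabola (6 / 5) := hclosed.frontier_subset hP
    have hnot : (ξ, η) ∉ strictRegion (1 / 5) (37 / 40) := fun h =>
      hS.2 (interior_maximal (strictRegion_subset (by norm_num))
        (isOpen_strictRegion (by norm_num)) h)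
    obtain ⟨z, hz, hz1⟩ : ∃ z, (charPoly (1 / 5) (37 / 40) ξ η).IsRoot z ∧ 1 ≤ ‖z‖ := by
      by_contra! hall
      exact hnot ⟨hξ, hall⟩
    have hn : ‖z‖ = 1 :=
      le_antisymm ((parabola_subset_stabilityRegion hmem).2.2 z hz).1 hz1
    obtain ⟨c, s⟩ := z
    have hle : η ^ 2 ≤ 6 / 5 * -ξ := by
      have := hmem.2
      rwa [abs_of_neg hξ] at this
    rw [← neg_neg ξ] at hz
    rcases locus_optimal (by linarith) (sq_add_sq_of_norm_eq_one hn) hz hle with h | ⟨h, h'⟩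
    · linarith
    · refine ⟨by linarith, ?_⟩
      rw [← sq_eq_sq₀ hη.le hpos.le, hsq, h', h]
      norm_num
  · rintro ⟨rfl, rfl⟩
    have hmem : ((-10 / 7, 2 * √(3 / 7)) : ℝ × ℝ) ∈ parabola (6 / 5) := by
      refine ⟨by norm_num, ?_⟩
      rw [hsq]
      norm_num [abs_of_neg]
    obtain ⟨s, hs, he⟩ := tangency_locus hsq
    have hroot := isRoot_charPoly_of_locus (u := 11 / 20) (v := 0) (q := 10 / 7) hs
      (by norm_num) he
    have hcl := mem_closure_compl_stabilityRegion hs hroot (by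
      have : s ^ 2 = 21 / 25 := by linarith
      rw [this]
      norm_num)
    norm_num at hcl
    have hfS : ((-10 / 7, 2 * √(3 / 7)) : ℝ × ℝ) ∈
        frontier (stabilityRegion (1 / 5) (37 / 40)) := by
      rw [frontier_eq_closure_inter_closure]
      refine ⟨subset_closure (parabola_subset_stabilityRegion hmem), ?_⟩
      rw [closure_compl]
      norm_num
      exact hcl
    refine ⟨⟨?_, hfS⟩, by norm_num, hpos⟩
    rw [frontier_eq_closure_inter_closure]
    refine ⟨subset_closure hmem, closure_mono (compl_subset_compl.2
      parabola_subset_stabilityRegion) ?_⟩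
    rw [frontier_eq_closure_inter_closure] at hfS
    exact hfS.2

end IMEX

theorem theorem6p1 :
    IsGreatest
      {m : ℝ | 0 < m ∧ ∃ β ∈ IMEX.W, IMEX.parabola m ⊆ IMEX.stabilityRegion β.1 β.2} (6 / 5) ∧
    (∀ β ∈ IMEX.W,
      IMEX.parabola (6 / 5) ⊆ IMEX.stabilityRegion β.1 β.2 ↔ β = (1 / 5, 37 / 40)) ∧
    frontier (IMEX.parabola (6 / 5)) ∩ frontier (IMEX.stabilityRegion (1 / 5) (37 / 40)) ∩
        {p : ℝ × ℝ | p.1 < 0 ∧ 0 < p.2} =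
      {(-10 / 7, 2 * Real.sqrt (3 / 7))} := by
  refine ⟨⟨⟨by norm_num, _, IMEX.optimal_mem_W, IMEX.parabola_subset_stabilityRegion⟩, ?_⟩,
    fun β hβ => ⟨IMEX.eq_of_parabola_subset hβ, ?_⟩, IMEX.frontier_inter_frontier⟩
  · rintro m ⟨-, β, hβ, h⟩
    exact IMEX.le_of_parabola_subset hβ h
  · rintro rfl
    exact IMEX.parabola_subset_stabilityRegion
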